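/- Let $d\ge 2$ be an integer. An \emph{Archimedean generator} is a continuous function $\psi:[0,\infty)\to[0,\infty)$ that is strictly decreasing on $\{\psi>0\}$ and satisfies $\psi(0)=1$ and $\lim_{x\to\infty}\psi(x)=0$. It is \emph{$d$-monotone} if it is $d-2$ times differentiable on $(0,\infty)$ with $(-1)^k\psi^{(k)}\ge 0$ there for $k=0,\dots,d-2$, and $(-1)^{d-2}\psi^{(d-2)}$ is non-increasing and convex on $(0,\infty)$. A positive measurable function $f$ on $(0,\infty)$ is in $\mathrm{RV}_{\rho}$, $\rho\in\mathbb R$, if $\lim_{x\to\infty}f(cx)/f(x)=c^{\rho}$ for every $c>0$; it is in $\mathrm{RV}_{-\infty}$ if this limit is $0$ for every $c>1$ and $\infty$ for every $0<c<1$. For distribution functions $F,G$ on $\mathbb R$ with $G$ non-degenerate (not the distribution function of a point mass), $F\in\mathrm{MDA}(G)$ means that there are $c_n>0$ and $d_n\in\mathbb R$ such that $F(c_nx+d_n)^n\to G(x)$ as $n\to\infty$ at every continuity point $x$ of $G$. For $\alpha>0$, let $\Psi_\alpha(x)=\exp\{-(-x)^{\alpha}\}$ for $x<0$ and $\Psi_\alpha(x)=1$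 for $x\ge 0$ (the Weibull extreme value distribution). Let $\psi$ be a $d$-monotone Archimedean generator, and let $\tilde\psi$ be the distribution function with $\tilde\psi(x)=\psi(-x)$ for $x\le 0$ and $\tilde\psi(x)=1$ for $x>0$. Then: (i) If the function $x\mapsto 1-\psi(1/x)$ on $(0,\infty)$ is in $\mathrm{RV}_{-\alpha}$ for some $\alpha\in\mathbb R\cup\{\infty\}$, then $\alpha\in[0,1]$. (In particular it is never in $\mathrm{RV}_{-\infty}$.) (ii) If $\tilde\psi\in\mathrm{MDA}(G)$ for some non-degenerate distribution function $G$, then $\tilde\psi\in\mathrm{MDA}(\Psi_\alpha)$ for some $\alpha\in(0,1]$. -/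

import Mathlib

open Filter Topology Set

noncomputable section

namespace ArchEVT

/-- An Archimedean generator `ψ : [0,∞) → [0,∞)`, represented by a function on `ℝ` of which only
the values on `[0,∞)` are used. -/
structure IsArchimedeanGenerator (ψ : ℝ → ℝ) : Prop where
  nonneg : ∀ x, 0 ≤ x → 0 ≤ ψ x
  continuousOn : ContinuousOn ψ (Ici 0)
  strictAntiOn : StrictAntiOn ψ {x | 0 ≤ x ∧ 0 < ψ x}
  map_zero : ψ 0 = 1
  tendsto_zero : Tendsto ψ atTop (𝓝 0)

/-- `d`-monotonicity (for `d ≥ 2`) of a function on `[0,∞)`: it is `d - 2` times differentiable in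
`(0,∞)`, the derivatives alternate in sign, and `(-1)^(d-2) f^(d-2)` is non-increasing and
convex in `(0,∞)`. -/
structure IsDMonotone (d : ℕ) (f : ℝ → ℝ) : Prop where
  two_le : 2 ≤ d
  differentiableOn : ∀ k, k < d - 2 → DifferentiableOn ℝ (iteratedDeriv k f) (Ioi 0)
  sign : ∀ k, k ≤ d - 2 → ∀ x, 0 < x → 0 ≤ (-1 : ℝ) ^ k * iteratedDeriv k f x
  antitoneOn : AntitoneOn (fun x => (-1 : ℝ) ^ (d - 2) * iteratedDeriv (d - 2) f x) (Ioi 0)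
  convexOn : ConvexOn ℝ (Ioi 0) (fun x => (-1 : ℝ) ^ (d - 2) * iteratedDeriv (d - 2) f x)

/-- `f ∈ RV_ρ`: a positive, measurable function on `(0,∞)`, regularly varying at infinity with
real index `ρ`. -/
structure IsRegularlyVarying (f : ℝ → ℝ) (ρ : ℝ) : Prop where
  pos : ∀ x, 0 < x → 0 < f x
  measurable : Measurable (fun x : Ioi (0 : ℝ) => f x)
  tendsto : ∀ c : ℝ, 0 < c → Tendsto (fun x => f (c * x) / f x) atTop (𝓝 (c ^ ρ))

/-- `f ∈ RV_{-∞}`: a positive, measurable function on `(0,∞)`, rapidly varying at infinity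
with index `-∞`. -/
structure IsRapidlyVarying (f : ℝ → ℝ) : Prop where
  pos : ∀ x, 0 < x → 0 < f x
  measurable : Measurable (fun x : Ioi (0 : ℝ) => f x)
  tendsto_zero : ∀ c : ℝ, 1 < c → Tendsto (fun x => f (c * x) / f x) atTop (𝓝 0)
  tendsto_atTop : ∀ c : ℝ, 0 < c → c < 1 → Tendsto (fun x => f (c * x) / f x) atTop atTop

/-- (Cumulative) probability distribution functions on the real line. -/
structure IsDistributionFunction (F : ℝ → ℝ) : Prop where
  monotone : Monotone F
  rightContinuous : ∀ x, ContinuousWithinAt F (Ici x) x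
  tendsto_atBot : Tendsto F atBot (𝓝 0)
  tendsto_atTop : Tendsto F atTop (𝓝 1)

/-- A distribution function is degenerate if it is that of a point mass. -/
def IsDegenerate (G : ℝ → ℝ) : Prop :=
  ∃ a : ℝ, ∀ x, G x = if a ≤ x then 1 else 0

/-- Weak convergence of distribution functions: convergence at all continuity points of the
limit. -/
def WeaklyConverges (F : ℕ → ℝ → ℝ) (G : ℝ → ℝ) : Prop :=
  ∀ x, ContinuousAt G x → Tendsto (fun n => F n x) atTop (𝓝 (G x))

/-- `F ∈ MDA(G)`: `F` and `G` are distribution functions, `G` is non-degenerate, and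
`F^n(c_n x + d_n) → G(x)` weakly for some `c_n > 0` and `d_n ∈ ℝ`. -/
structure InMDA (F G : ℝ → ℝ) : Prop where
  left : IsDistributionFunction F
  right : IsDistributionFunction G
  nondegenerate : ¬ IsDegenerate G
  exists_norming : ∃ c b : ℕ → ℝ, (∀ n, 0 < c n) ∧
    WeaklyConverges (fun n x => F (c n * x + b n) ^ n) G

/-- The Weibull extreme value distribution function `Ψ_α`. -/
def weibullDF (α : ℝ) (x : ℝ) : ℝ :=
  if x < 0 then Real.exp (-((-x) ^ α)) else 1

/-- `ψ̃(x) = ψ(-x)` as a distribution function on `(-∞,0]`, hence equal to `1` on `(0,∞)`. -/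
def reflectedDF (ψ : ℝ → ℝ) (x : ℝ) : ℝ :=
  if x ≤ 0 then ψ (-x) else 1

end ArchEVT

end

namespace ArchEVT

/-! Only convexity of `ψ` on `[0,∞)` is extracted from `d`-monotonicity. Then `1 - ψ` is concave,
nondecreasing and zero at `0`, so halving the argument multiplies it by a factor in `[1/2, 1] =
[2⁻¹, 2⁰]`; this gives (i).

For (ii), let `F` be the reflected distribution function, convex on `(-∞,0]`. If `F(c_n x + b_n)^n →
G(x) > 0`, then `n(1 - F(c_n x + b_n)) → -log G(x)`, and concavity of the left side passes to the
limit wherever `G < 1`. It forces `G > 0` everywhere (`limit_pos`) and a finite right endpoint `e`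
(`bddAbove_limit_lt_one`), which rules out Fréchet and Gumbel behaviour without the classification
of extreme value laws. Moreover `-b_n / c_n → e` (`tendsto_norming`), so the centering can be
removed: with `h(y) = 1 - F(-y)`, `n h(c_n y) → k(y) = -log G(e - y)`. Comparing scales at different
indices makes `k / k(1)` multiplicative (`limit_mul_limit`), hence a power; strict monotonicity and
concavity of `k` put its exponent in `(0,1]`. -/

theorem IsDMonotone.convexOn_Ioi {d : ℕ} {f : ℝ → ℝ} (hf : IsDMonotone d f) :
    ConvexOn ℝ (Ioi 0) f := by
  obtain ⟨h2, hdiff, hsign, hanti, hconv⟩ := hf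
  obtain ⟨m, rfl⟩ := Nat.exists_eq_add_of_le h2
  simp only [Nat.add_sub_cancel_left] at *
  -- The cases are `d = 2`, `d = 3` and `d ≥ 4`. Only the last provides a second derivative; for `d
  -- = 3` convexity comes from the monotone first derivative.
  rcases m with _ | _ | m
  · simpa using hconv
  · have h0 := hdiff 0 (by norm_num)
    simp only [iteratedDeriv_zero] at h0
    refine MonotoneOn.convexOn_of_deriv (convex_Ioi 0) h0.continuousOn
      (by simpa using h0) ?_
    rw [interior_Ioi]
    intro x hx y hy hxy
    have := hanti hx hy hxy
    simp at this
    exact this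
  · have h0 := hdiff 0 (by omega)
    have h1 := hdiff 1 (by omega)
    simp only [iteratedDeriv_zero, iteratedDeriv_one] at h0 h1
    refine convexOn_of_deriv2_nonneg (convex_Ioi 0) h0.continuousOn
      (by simpa using h0) (by simpa using h1) ?_
    intro x hx
    rw [interior_Ioi] at hx
    have := hsign 2 (by omega) x hx
    rw [iteratedDeriv_eq_iterate] at this
    simpa using this

/-- A continuous function on `[0,∞)` that is convex on `(0,∞)` is convex on `[0,∞)`. -/
theorem convexOn_Ici_of_convexOn_Ioi {f : ℝ → ℝ} (hf : ConvexOn ℝ (Ioi 0) f)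
    (hc : ContinuousOn f (Ici 0)) : ConvexOn ℝ (Ici 0) f := by
  refine ⟨convex_Ici 0, ?_⟩
  intro x hx y hy a b ha hb hab
  -- A common shift by `δ > 0` moves all points into `(0,∞)` and commutes with convex combinations;
  -- then `δ → 0`.
  have key : ∀ z : ℝ, 0 ≤ z → Tendsto (fun δ : ℝ => f (z + δ)) (𝓝[>] 0) (𝓝 (f z)) := by
    intro z hz
    have h1 : Tendsto (fun δ : ℝ => z + δ) (𝓝[>] 0) (𝓝[Ici 0] z) := by
      refine tendsto_nhdsWithin_iff.2 ⟨?_, ?_⟩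
      · have : Tendsto (fun δ : ℝ => z + δ) (𝓝 0) (𝓝 (z + 0)) := by
          apply Continuous.tendsto; fun_prop
        rw [add_zero] at this
        exact this.mono_left nhdsWithin_le_nhds
      · filter_upwards [self_mem_nhdsWithin] with δ hδ
        exact add_nonneg hz (le_of_lt hδ)
    exact (hc z hz).tendsto.comp h1
  have hx' : (0 : ℝ) ≤ x := hx
  have hy' : (0 : ℝ) ≤ y := hy
  have hz : 0 ≤ a • x + b • y := by simp only [smul_eq_mul]; positivity
  refine le_of_tendsto_of_tendsto (key _ hz)
    (((key x hx).const_smul a).add ((key y hy).const_smul b)) ?_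
  filter_upwards [self_mem_nhdsWithin] with δ hδ
  have hδ' : (0 : ℝ) < δ := hδ
  have := hf.2 (show x + δ ∈ Ioi 0 by simp; linarith) (show y + δ ∈ Ioi 0 by simp; linarith)
    ha hb hab
  have e : a • (x + δ) + b • (y + δ) = a • x + b • y + δ := by
    simp only [smul_eq_mul]; linear_combination δ * hab
  rwa [e] at this

/-! ### Archimedean generators and the bound on the index -/

variable {ψ : ℝ → ℝ}

theorem IsArchimedeanGenerator.lt_one (hψ : IsArchimedeanGenerator ψ) {x : ℝ} (hx : 0 < x) :
    ψ x < 1 := by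
  rcases (hψ.nonneg x hx.le).eq_or_lt with h | h
  · rw [← h]; exact one_pos
  · have := hψ.strictAntiOn (a := 0) (b := x) ⟨le_rfl, by simp [hψ.map_zero]⟩ ⟨hx.le, h⟩ hx
    rwa [hψ.map_zero] at this

/-- Strict decrease on `{ψ > 0}` does not by itself prevent `ψ` from leaving `0` again. A convex
function that rises can never come back down, contradicting the limit `0`. -/
theorem IsArchimedeanGenerator.antitoneOn (hψ : IsArchimedeanGenerator ψ)
    (hc : ConvexOn ℝ (Ici 0) ψ) : AntitoneOn ψ (Ici 0) := by
  intro x hx y hy hxy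
  by_contra! hlt
  have hxy' : x < y := lt_of_le_of_ne hxy (by rintro rfl; exact lt_irrefl _ hlt)
  have hpos : 0 < ψ y := (hψ.nonneg x hx).trans_lt hlt
  rcases (hψ.nonneg x hx).eq_or_lt with h | h
  · have hev := (hψ.tendsto_zero.eventually (gt_mem_nhds hpos)).and (eventually_gt_atTop y)
    obtain ⟨z, hz, hyz⟩ := hev.exists
    have := hc.slope_mono_adjacent hx (show z ∈ Ici (0:ℝ) from le_trans hy hyz.le) hxy' hyz
    have h1 : 0 < (ψ y - ψ x) / (y - x) := div_pos (by linarith) (by linarith)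
    have h2 : (ψ z - ψ y) / (z - y) < 0 := div_neg_of_neg_of_pos (by linarith) (by linarith)
    linarith
  · exact lt_asymm hlt (hψ.strictAntiOn ⟨hx, h⟩ ⟨hy, hpos⟩ hxy')

/-- The lower bound is convexity on the segment from `0` to `x⁻¹`, the upper bound is monotonicity.
The single ratio `c = 2` already determines the index. -/
theorem one_sub_div_bounds (hψ : IsArchimedeanGenerator ψ) (hc : ConvexOn ℝ (Ici 0) ψ)
    {x : ℝ} (hx : 0 < x) :
    (1 - ψ (2 * x)⁻¹) / (1 - ψ x⁻¹) ∈ Icc (1 / 2 : ℝ) 1 := by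
  have hpos : 0 < 1 - ψ x⁻¹ := by linarith [hψ.lt_one (inv_pos.2 hx)]
  have hx' : 0 < x⁻¹ := inv_pos.2 hx
  have e : (2 * x)⁻¹ = (1 / 2 : ℝ) • (0 : ℝ) + (1 / 2 : ℝ) • x⁻¹ := by
    rw [mul_inv, smul_eq_mul, smul_eq_mul]; ring
  have h1 := hc.2 (show (0 : ℝ) ∈ Ici 0 from self_mem_Ici) (show x⁻¹ ∈ Ici (0 : ℝ) from hx'.le)
    (show (0 : ℝ) ≤ 1 / 2 by norm_num) (show (0 : ℝ) ≤ 1 / 2 by norm_num) (by norm_num)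
  rw [← e, hψ.map_zero, smul_eq_mul, smul_eq_mul] at h1
  have e2 : (2 * x)⁻¹ = x⁻¹ / 2 := by rw [mul_inv]; ring
  have h2 : ψ x⁻¹ ≤ ψ (2 * x)⁻¹ := by
    rw [e2]
    exact hψ.antitoneOn hc (show 0 ≤ x⁻¹ / 2 by positivity) hx'.le (by linarith)
  constructor
  · rw [le_div_iff₀ hpos]; linarith
  · rw [div_le_one hpos]; linarith

theorem index_mem_Icc (hψ : IsArchimedeanGenerator ψ) (hc : ConvexOn ℝ (Ici 0) ψ) {α : ℝ}
    (h : IsRegularlyVarying (fun x => 1 - ψ x⁻¹) (-α)) : α ∈ Icc (0 : ℝ) 1 := by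
  have ht := h.tendsto 2 two_pos
  have hm : (2 : ℝ) ^ (-α) ∈ Icc (1 / 2 : ℝ) 1 := by
    refine isClosed_Icc.mem_of_tendsto ht ?_
    filter_upwards [eventually_gt_atTop 0] with x hx
    exact one_sub_div_bounds hψ hc hx
  have e1 : (1 / 2 : ℝ) = 2 ^ (-1 : ℝ) := by rw [Real.rpow_neg_one]; norm_num
  have e2 : (1 : ℝ) = 2 ^ (0 : ℝ) := by rw [Real.rpow_zero]
  obtain ⟨ha, hb⟩ := hm
  rw [e1, Real.rpow_le_rpow_left_iff one_lt_two] at ha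
  rw [e2, Real.rpow_le_rpow_left_iff one_lt_two] at hb
  constructor <;> linarith

theorem not_isRapidlyVarying (hψ : IsArchimedeanGenerator ψ) (hc : ConvexOn ℝ (Ici 0) ψ) :
    ¬ IsRapidlyVarying (fun x => 1 - ψ x⁻¹) := by
  intro h
  have ht := h.tendsto_zero 2 one_lt_two
  have hm : (0 : ℝ) ∈ Icc (1 / 2 : ℝ) 1 := by
    refine isClosed_Icc.mem_of_tendsto ht ?_
    filter_upwards [eventually_gt_atTop 0] with x hx
    exact one_sub_div_bounds hψ hc hx
  have := hm.1
  norm_num at this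

/-! ### Monotone limits, concave functions and power functions -/

/-- Pointwise limits of monotone functions converge along moving arguments, at continuity points
of the limit. -/
theorem tendsto_comp_of_monotone {ι : Type*} {l : Filter ι} {φ : ι → ℝ → ℝ} {γ : ℝ → ℝ}
    {s : Set ℝ} (hs : IsOpen s) (hφ : ∀ i, Monotone (φ i))
    (hlim : ∀ y ∈ s, Tendsto (fun i => φ i y) l (𝓝 (γ y))) {y₀ : ℝ} (hy₀ : y₀ ∈ s)
    (hγ : ContinuousAt γ y₀) {r : ι → ℝ} (hr : Tendsto r l (𝓝 y₀)) :
    Tendsto (fun i => φ i (r i)) l (𝓝 (γ y₀)) := by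
  have hev : ∀ᶠ y in 𝓝 y₀, y ∈ s := hs.mem_nhds hy₀
  refine tendsto_order.2 ⟨fun a ha => ?_, fun a ha => ?_⟩
  · have h1 : ∀ᶠ y in 𝓝[<] y₀, (y ∈ s ∧ a < γ y) ∧ y < y₀ :=
      ((hev.and (hγ.eventually (lt_mem_nhds ha))).filter_mono nhdsWithin_le_nhds).and
        self_mem_nhdsWithin
    obtain ⟨y, ⟨hys, hya⟩, hy⟩ := h1.exists
    filter_upwards [(hlim y hys).eventually (lt_mem_nhds hya), hr.eventually (lt_mem_nhds hy)]
      with i h2 h3 using h2.trans_le (hφ i h3.le)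
  · have h1 : ∀ᶠ y in 𝓝[>] y₀, (y ∈ s ∧ γ y < a) ∧ y₀ < y :=
      ((hev.and (hγ.eventually (gt_mem_nhds ha))).filter_mono nhdsWithin_le_nhds).and
        self_mem_nhdsWithin
    obtain ⟨y, ⟨hys, hya⟩, hy⟩ := h1.exists
    filter_upwards [(hlim y hys).eventually (gt_mem_nhds hya), hr.eventually (gt_mem_nhds hy)]
      with i h2 h3 using (hφ i h3.le).trans_lt h2

/-- A monotone concave function which is unbounded above is strictly monotone. -/
theorem strictMonoOn_of_concaveOn {k : ℝ → ℝ} (hc : ConcaveOn ℝ (Ioi 0) k)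
    (hm : MonotoneOn k (Ioi 0)) (ht : Tendsto k atTop atTop) : StrictMonoOn k (Ioi 0) := by
  intro x hx y hy hxy
  refine (hm hx hy hxy.le).lt_of_ne fun heq => ?_
  obtain ⟨z, hz, hyz⟩ := ((ht.eventually_gt_atTop (k y)).and (eventually_gt_atTop y)).exists
  have := hc.slope_anti_adjacent hx (show z ∈ Ioi (0 : ℝ) from lt_trans hy hyz) hxy hyz
  rw [heq, sub_self, zero_div] at this
  have h2 : 0 < (k z - k y) / (z - y) := div_pos (by linarith) (by linarith)
  linarith

/-- Continuous multiplicative functions on `(0,∞)` are powers. -/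
theorem exists_rpow_of_mul {H : ℝ → ℝ} (hpos : ∀ x, 0 < x → 0 < H x)
    (hcont : ContinuousOn H (Ioi 0)) (hmul : ∀ x y, 0 < x → 0 < y → H (x * y) = H x * H y) :
    ∃ α : ℝ, ∀ x, 0 < x → H x = x ^ α := by
  -- In logarithmic coordinates `H` becomes a continuous additive map, hence linear.
  let L : ℝ →+ ℝ := AddMonoidHom.mk' (fun t => Real.log (H (Real.exp t))) fun s t => by
    rw [Real.exp_add, hmul _ _ (Real.exp_pos _) (Real.exp_pos _),
      Real.log_mul (hpos _ (Real.exp_pos _)).ne' (hpos _ (Real.exp_pos _)).ne']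
  have hL : Continuous L := by
    refine Continuous.log ?_ fun t => (hpos _ (Real.exp_pos _)).ne'
    exact hcont.comp_continuous Real.continuous_exp fun t => Real.exp_pos t
  refine ⟨L 1, fun x hx => ?_⟩
  have h1 := map_real_smul L hL (Real.log x) 1
  simp only [smul_eq_mul, mul_one] at h1
  have h2 : L (Real.log x) = Real.log (H x) := by
    change Real.log (H (Real.exp (Real.log x))) = _
    rw [Real.exp_log hx]
  rw [Real.rpow_def_of_pos hx, ← h1, h2, Real.exp_log (hpos x hx)]

/-! ### Limits under rescaling are powers -/

section PowerLimit

variable {h k : ℝ → ℝ} {c : ℕ → ℝ}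

theorem monotoneOn_limit (hm : Monotone h) (hc : ∀ n, 0 < c n)
    (hlim : ∀ y, 0 < y → Tendsto (fun n : ℕ => n * h (c n * y)) atTop (𝓝 (k y))) :
    MonotoneOn k (Ioi 0) := fun x hx y hy hxy =>
  le_of_tendsto_of_tendsto' (hlim x hx) (hlim y hy) fun n =>
    mul_le_mul_of_nonneg_left (hm (mul_le_mul_of_nonneg_left hxy (hc n).le)) n.cast_nonneg

/-- An index `m(n)` is chosen so that `c_{m(n)} z` and `c_n y` are asymptotically equal. Then `m(n)
h(c_n t y)` has limit `k(tz)` on the scale `c_{m(n)}`, and limit `(k z / k y) k(ty)` on the scale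
`c_n`. -/
theorem limit_mul_limit (hm : Monotone h) (hh : ∀ y, 0 < y → 0 < h y) (hc : ∀ n, 0 < c n)
    (hlim : ∀ y, 0 < y → Tendsto (fun n : ℕ => n * h (c n * y)) atTop (𝓝 (k y)))
    (hk : ∀ y, 0 < y → 0 < k y) (hconc : ConcaveOn ℝ (Ioi 0) k) (ht : Tendsto k atTop atTop)
    {t y z : ℝ} (ht0 : 0 < t) (hy : 0 < y) (hz : 0 < z) :
    k (t * z) * k y = k z * k (t * y) := by
  have hstrict := strictMonoOn_of_concaveOn hconc (monotoneOn_limit hm hc hlim) ht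
  have hcont : ContinuousOn k (Ioi 0) := hconc.continuousOn isOpen_Ioi
  have hzero : Tendsto (fun n => h (c n * y)) atTop (𝓝[>] 0) := by
    refine tendsto_nhdsWithin_iff.2
      ⟨?_, Eventually.of_forall fun n => hh _ (mul_pos (hc n) hy)⟩
    have h1 := (hlim y hy).mul (tendsto_inv_atTop_zero.comp (tendsto_natCast_atTop_atTop (R := ℝ)))
    rw [mul_zero] at h1
    refine h1.congr' ?_
    filter_upwards [eventually_gt_atTop 0] with n hn
    have : (n : ℝ) ≠ 0 := by positivity
    simp only [Function.comp]
    field_simp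
  have hinv : Tendsto (fun n => (h (c n * y))⁻¹) atTop atTop :=
    tendsto_inv_nhdsGT_zero.comp hzero
  set m : ℕ → ℕ := fun n => ⌊k z * (h (c n * y))⁻¹⌋₊ with hmdef
  have hmtop : Tendsto m atTop atTop :=
    tendsto_nat_floor_atTop.comp (hinv.const_mul_atTop (hk z hz))
  have hmh : Tendsto (fun n => (m n : ℝ) * h (c n * y)) atTop (𝓝 (k z)) := by
    have := (tendsto_nat_floor_mul_div_atTop (hk z hz).le).comp hinv
    refine this.congr fun n => ?_
    simp [hmdef, Function.comp]
  have hmn : Tendsto (fun n : ℕ => (m n : ℝ) / n) atTop (𝓝 (k z / k y)) := by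
    refine (hmh.div (hlim y hy) (hk y hy).ne').congr fun n => ?_
    exact mul_div_mul_right _ _ (hh _ (mul_pos (hc n) hy)).ne'
  set r : ℕ → ℝ := fun n => c n * y / c (m n) with hrdef
  have hcr : ∀ n, c (m n) * r n = c n * y := fun n => mul_div_cancel₀ _ (hc _).ne'
  -- Since `m(n) h(c_{m(n)} r_n) → k(z)`, strict monotonicity of `k` leaves `z` as the only possible
  -- limit of `r_n`.
  have hr : Tendsto r atTop (𝓝 z) := by
    refine tendsto_order.2 ⟨fun a ha => ?_, fun a ha => ?_⟩
    · obtain ⟨a', ha', haz⟩ : ∃ a', max a 0 < a' ∧ a' < z := exists_between (max_lt ha hz)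
      have ha0 : 0 < a' := (le_max_right _ _).trans_lt ha'
      have h1 := hmh.sub ((hlim a' ha0).comp hmtop)
      have h2 : 0 < k z - k a' := sub_pos.2 (hstrict ha0 hz haz)
      filter_upwards [h1.eventually (lt_mem_nhds h2)] with n hn
      refine ((le_max_left _ _).trans_lt ha').trans ?_
      by_contra! hcon
      have h3 : h (c n * y) ≤ h (c (m n) * a') := by
        rw [← hcr n]; exact hm (mul_le_mul_of_nonneg_left hcon (hc _).le)
      have h4 := mul_le_mul_of_nonneg_left h3 (m n).cast_nonneg (α := ℝ)
      simp only [Function.comp] at hn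
      linarith
    · have ha0 : 0 < a := hz.trans ha
      have h1 := ((hlim a ha0).comp hmtop).sub hmh
      have h2 : 0 < k a - k z := sub_pos.2 (hstrict hz ha0 ha)
      filter_upwards [h1.eventually (lt_mem_nhds h2)] with n hn
      by_contra! hcon
      have h3 : h (c (m n) * a) ≤ h (c n * y) := by
        rw [← hcr n]; exact hm (mul_le_mul_of_nonneg_left hcon (hc _).le)
      have h4 := mul_le_mul_of_nonneg_left h3 (m n).cast_nonneg (α := ℝ)
      simp only [Function.comp] at hn
      linarith
  have htz : 0 < t * z := mul_pos ht0 hz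
  have h1 : Tendsto (fun n => (m n : ℝ) * h (c (m n) * (t * r n))) atTop (𝓝 (k (t * z))) :=
    tendsto_comp_of_monotone (φ := fun n x => (m n : ℝ) * h (c (m n) * x)) isOpen_Ioi
      (fun n a b hab => mul_le_mul_of_nonneg_left
        (hm (mul_le_mul_of_nonneg_left hab (hc _).le)) (Nat.cast_nonneg _))
      (fun x hx => (hlim x hx).comp hmtop) htz (hcont.continuousAt (Ioi_mem_nhds htz))
      (hr.const_mul t)
  have h2 := hmn.mul (hlim (t * y) (mul_pos ht0 hy))
  have h3 := tendsto_nhds_unique_of_eventuallyEq h1 h2 (by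
    filter_upwards [eventually_gt_atTop 0] with n hn
    have hn' : (n : ℝ) ≠ 0 := by positivity
    rw [show c (m n) * (t * r n) = c n * (t * y) by rw [mul_left_comm, hcr]; ring]
    field_simp)
  rw [h3]
  field_simp [(hk y hy).ne']

/-- A concave unbounded limit of `n h(c_n y)` is a multiple of a power with exponent in
`(0,1]`. -/
theorem exists_rpow_limit (hm : Monotone h) (hh : ∀ y, 0 < y → 0 < h y) (hc : ∀ n, 0 < c n)
    (hlim : ∀ y, 0 < y → Tendsto (fun n : ℕ => n * h (c n * y)) atTop (𝓝 (k y)))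
    (hk : ∀ y, 0 < y → 0 < k y) (hconc : ConcaveOn ℝ (Ioi 0) k) (ht : Tendsto k atTop atTop) :
    ∃ α ∈ Ioc (0 : ℝ) 1, ∀ y, 0 < y → k y = k 1 * y ^ α := by
  have h1 := hk 1 one_pos
  obtain ⟨α, hα⟩ := exists_rpow_of_mul (H := fun y => k y / k 1) (fun y hy => div_pos (hk y hy) h1)
    ((hconc.continuousOn isOpen_Ioi).div_const _) (fun x y hx hy => by
      have := limit_mul_limit hm hh hc hlim hk hconc ht hx one_pos hy
      rw [mul_one] at this
      field_simp
      linarith)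
  have hα' : ∀ y, 0 < y → k y = k 1 * y ^ α := fun y hy => by
    rw [← hα y hy]; field_simp
  have hstrict := strictMonoOn_of_concaveOn hconc (monotoneOn_limit hm hc hlim) ht
  refine ⟨α, ⟨?_, ?_⟩, hα'⟩
  · have h2 := hstrict (show (1 : ℝ) ∈ Ioi 0 by simp) (show (2 : ℝ) ∈ Ioi 0 by simp)
      one_lt_two
    rw [hα' 2 two_pos] at h2
    by_contra! hcon
    have := Real.rpow_le_one_of_one_le_of_nonpos one_le_two hcon
    nlinarith
  · by_contra! hcon
    have hs : 1 < (2 : ℝ) ^ α - 1 := by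
      have := Real.rpow_lt_rpow_of_exponent_lt one_lt_two hcon
      rw [Real.rpow_one] at this
      linarith
    set s : ℝ := (2 : ℝ) ^ α - 1 with hsdef
    have hs0 : 0 < s := one_pos.trans hs
    -- The slope of `k` on `[1,2]` is `s · k 1`. With `ε = (s - 1) / (2s)`, concavity gives `k 1 - k
    -- ε ≥ s(1 - ε) k 1 = (s + 1)/2 · k 1 > k 1`, against `k ε > 0`.
    have hε : 0 < (s - 1) / (2 * s) := div_pos (by linarith) (by linarith)
    have hε1 : 1 - (s - 1) / (2 * s) = (s + 1) / (2 * s) := by field_simp; ring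
    have hd : 0 < (s + 1) / (2 * s) := by positivity
    have h2 := hconc.slope_anti_adjacent hε (show (2 : ℝ) ∈ Ioi 0 by simp)
      (show (s - 1) / (2 * s) < 1 by linarith) one_lt_two
    have h3 := hk _ hε
    rw [hε1, hα' 2 two_pos, le_div_iff₀ hd] at h2
    have h4 : (k 1 * 2 ^ α - k 1) / (2 - 1) * ((s + 1) / (2 * s)) = k 1 * ((s + 1) / 2) := by
      rw [show k 1 * 2 ^ α - k 1 = k 1 * s by rw [hsdef]; ring]
      field_simp
      norm_num
    rw [h4] at h2
    nlinarith

end PowerLimit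

/-! ### From powers to tails -/

/-- Here `p_n → 1`, and `-p log p ≤ 1 - p ≤ -log p` squeezes the tail. -/
theorem tendsto_mul_one_sub_of_pow {p : ℕ → ℝ} {l : ℝ} (hp0 : ∀ n, 0 ≤ p n)
    (hl : 0 < l) (h : Tendsto (fun n => p n ^ n) atTop (𝓝 l)) :
    Tendsto (fun n : ℕ => n * (1 - p n)) atTop (𝓝 (-Real.log l)) := by
  have hev : ∀ᶠ n : ℕ in atTop, 0 < p n ∧ 0 < n := by
    filter_upwards [h.eventually (lt_mem_nhds hl), eventually_gt_atTop 0] with n hn hn0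
    refine ⟨(hp0 n).lt_of_ne fun h0 => ?_, hn0⟩
    rw [← h0, zero_pow hn0.ne'] at hn
    exact lt_irrefl _ hn
  have hlog : Tendsto (fun n : ℕ => n * Real.log (p n)) atTop (𝓝 (Real.log l)) :=
    (h.log hl.ne').congr fun n => Real.log_pow _ _
  have hlog0 : Tendsto (fun n : ℕ => Real.log (p n)) atTop (𝓝 0) := by
    have h1 := hlog.mul (tendsto_inv_atTop_zero.comp (tendsto_natCast_atTop_atTop (R := ℝ)))
    rw [mul_zero] at h1
    refine h1.congr' ?_
    filter_upwards [eventually_gt_atTop 0] with n hn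
    have : (n : ℝ) ≠ 0 := by positivity
    simp only [Function.comp]
    field_simp
  have hpt : Tendsto p atTop (𝓝 1) := by
    have h1 := (Real.continuous_exp.tendsto 0).comp hlog0
    rw [Real.exp_zero] at h1
    refine h1.congr' ?_
    filter_upwards [hev] with n hn
    exact Real.exp_log hn.1
  have hlow : Tendsto (fun n : ℕ => p n * -(n * Real.log (p n))) atTop (𝓝 (-Real.log l)) := by
    have := hpt.mul hlog.neg
    rwa [one_mul] at this
  refine tendsto_of_tendsto_of_tendsto_of_le_of_le' hlow hlog.neg ?_ ?_
  · filter_upwards [hev] with n hn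
    have h1 := Real.one_sub_inv_le_log_of_pos hn.1
    have h2 : p n * (1 - (p n)⁻¹) ≤ p n * Real.log (p n) := mul_le_mul_of_nonneg_left h1 hn.1.le
    rw [mul_sub, mul_inv_cancel₀ hn.1.ne', mul_one] at h2
    have h3 := mul_le_mul_of_nonneg_left h2 (n.cast_nonneg (α := ℝ))
    linarith
  · filter_upwards [hev] with n hn
    have h1 := Real.log_le_sub_one_of_pos hn.1
    have h3 := mul_le_mul_of_nonneg_left h1 (n.cast_nonneg (α := ℝ))
    linarith

/-- Eventually `p_n ≥ 1 - M/n ≥ 0`, so the limit is at least `exp(-M)`. -/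
theorem limit_pow_pos {p : ℕ → ℝ} {l M : ℝ}
    (hM : ∀ᶠ n : ℕ in atTop, n * (1 - p n) ≤ M)
    (h : Tendsto (fun n => p n ^ n) atTop (𝓝 l)) : 0 < l := by
  refine (Real.exp_pos (-M)).trans_le
    (le_of_tendsto_of_tendsto (Real.tendsto_one_add_div_pow_exp (-M)) h ?_)
  filter_upwards [hM, eventually_gt_atTop 0, eventually_ge_atTop ⌈M⌉₊] with n hn hn0 hnM
  have hn' : (0 : ℝ) < n := by exact_mod_cast hn0
  have hnM' : M ≤ n := (Nat.le_ceil M).trans (by exact_mod_cast hnM)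
  refine pow_le_pow_left₀ ?_ ?_ n
  · rw [neg_div, ← sub_eq_add_neg, sub_nonneg, div_le_one hn']; exact hnM'
  · have : 1 - p n ≤ M / n := by rw [le_div_iff₀ hn']; linarith
    rw [neg_div]; linarith

/-! ### Distribution functions and their continuity points -/

namespace IsDistributionFunction

variable {G : ℝ → ℝ}

theorem nonneg (hG : IsDistributionFunction G) (x : ℝ) : 0 ≤ G x :=
  hG.monotone.le_of_tendsto hG.tendsto_atBot x

theorem le_one (hG : IsDistributionFunction G) (x : ℝ) : G x ≤ 1 :=
  hG.monotone.ge_of_tendsto hG.tendsto_atTop x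

theorem tendsto_nhdsGT (hG : IsDistributionFunction G) (x : ℝ) :
    Tendsto G (𝓝[>] x) (𝓝 (G x)) :=
  (hG.rightContinuous x).tendsto.mono_left (nhdsWithin_mono _ Ioi_subset_Ici_self)

theorem exists_continuousAt (hG : IsDistributionFunction G) {a b : ℝ} (hab : a < b) :
    ∃ x, a < x ∧ x < b ∧ ContinuousAt G x := by
  obtain ⟨x, hx, hax, hxb⟩ :=
    (hG.monotone.countable_not_continuousAt.dense_compl ℝ).exists_between hab
  exact ⟨x, hax, hxb, by simpa using hx⟩

theorem exists_mem_Ioo (hG : IsDistributionFunction G) (hnd : ¬ IsDegenerate G) :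
    ∃ x, 0 < G x ∧ G x < 1 := by
  by_contra! hcon
  apply hnd
  have h01 : ∀ x, G x ≠ 1 → G x = 0 := fun x hx => by
    by_contra h0
    exact hx (le_antisymm (hG.le_one x) (hcon x ((hG.nonneg x).lt_of_ne' h0)))
  obtain ⟨t, ht⟩ := (hG.tendsto_atTop.eventually (lt_mem_nhds zero_lt_one)).exists
  obtain ⟨s, hs⟩ := (hG.tendsto_atBot.eventually (gt_mem_nhds zero_lt_one)).exists
  have hne : {x | G x = 1}.Nonempty := ⟨t, by_contra fun h => ht.ne' (h01 t h)⟩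
  have hbdd : BddBelow {x | G x = 1} := ⟨s, fun x hx => by
    by_contra! hxs
    have := hG.monotone hxs.le
    rw [show G x = 1 from hx] at this
    linarith⟩
  have hgt : ∀ x, sInf {x | G x = 1} < x → G x = 1 := fun x hx => by
    obtain ⟨y, hy, hyx⟩ := exists_lt_of_csInf_lt hne hx
    exact le_antisymm (hG.le_one x) (le_of_eq_of_le (show G y = 1 from hy).symm
      (hG.monotone hyx.le))
  -- If `G` takes only the values `0` and `1`, it jumps at this infimum; right continuity settles
  -- the value there.
  refine ⟨sInf {x | G x = 1}, fun x => ?_⟩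
  split_ifs with hx
  · rcases hx.eq_or_lt with rfl | hx
    · refine tendsto_nhds_unique (hG.tendsto_nhdsGT _) (tendsto_const_nhds.congr' ?_)
      filter_upwards [self_mem_nhdsWithin] with y hy using (hgt y hy).symm
    · exact hgt x hx
  · exact h01 x fun h => hx (csInf_le hbdd h)

theorem exists_continuousAt_pair (hG : IsDistributionFunction G) (hnd : ¬ IsDegenerate G) :
    ∃ x y, x < y ∧ ContinuousAt G x ∧ ContinuousAt G y ∧ 0 < G x ∧ G y < 1 := by
  obtain ⟨x, hx0, hx1⟩ := hG.exists_mem_Ioo hnd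
  have h1 : ∀ᶠ z in 𝓝[>] x, G z < 1 ∧ x < z :=
    ((hG.tendsto_nhdsGT x).eventually (gt_mem_nhds hx1)).and self_mem_nhdsWithin
  obtain ⟨z, hz, hxz⟩ := h1.exists
  obtain ⟨v, hxv, hvz, hv⟩ := hG.exists_continuousAt hxz
  obtain ⟨u, hxu, huv, hu⟩ := hG.exists_continuousAt hxv
  exact ⟨u, v, huv, hu, hv, hx0.trans_le (hG.monotone hxu.le), (hG.monotone hvz.le).trans_lt hz⟩

/-- The common continuity points of three translates accumulate at `0` from the right. -/
theorem frequently_continuousAt (hG : IsDistributionFunction G) (x y z : ℝ) :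
    ∃ᶠ δ in 𝓝[>] (0 : ℝ),
      ContinuousAt G (x + δ) ∧ ContinuousAt G (y + δ) ∧ ContinuousAt G (z + δ) := by
  have hC : ∀ u : ℝ, {δ | ¬ ContinuousAt G (u + δ)}.Countable := fun u =>
    hG.monotone.countable_not_continuousAt.preimage_of_injOn
      (f := fun δ => u + δ) (add_right_injective u).injOn
  have hd := (((hC x).union (hC y)).union (hC z)).dense_compl ℝ
  rw [(nhdsGT_basis (0 : ℝ)).frequently_iff]
  intro ε hε
  obtain ⟨δ, hδ, h0, h1⟩ := hd.exists_between hε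
  simp only [mem_compl_iff, mem_union, mem_ofPred_eq, not_or, not_not] at hδ
  exact ⟨δ, ⟨h0, h1⟩, hδ.1.1, hδ.1.2, hδ.2⟩

end IsDistributionFunction

/-! ### Limit laws of distribution functions with a convex left branch -/

section ConvexTail

variable {F G : ℝ → ℝ} {c b : ℕ → ℝ}

/-- The chord inequality for the concave rescaled tail, with denominators cleared so that it passes
to limits termwise. Only the rightmost point has to be tested against the endpoint `0`. -/
theorem tail_concave (hconv : ConvexOn ℝ (Iic 0) F) (hc : ∀ n, 0 < c n) {n : ℕ} {x y z : ℝ}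
    (hxy : x < y) (hyz : y < z) (hz : c n * z + b n ≤ 0) :
    (z - y) * (n * (1 - F (c n * x + b n))) + (y - x) * (n * (1 - F (c n * z + b n))) ≤
      (z - x) * (n * (1 - F (c n * y + b n))) := by
  have hzx : 0 < z - x := by linarith
  have hx : c n * x + b n ≤ 0 := by nlinarith [hc n]
  have h1 := hconv.2 hx hz (div_nonneg (sub_nonneg.2 hyz.le) hzx.le)
    (div_nonneg (sub_nonneg.2 hxy.le) hzx.le) (by field_simp; ring)
  have e : ((z - y) / (z - x)) • (c n * x + b n) + ((y - x) / (z - x)) • (c n * z + b n) =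
      c n * y + b n := by
    simp only [smul_eq_mul]; field_simp; ring
  rw [e, smul_eq_mul, smul_eq_mul] at h1
  have h2 := mul_le_mul_of_nonneg_left h1 hzx.le
  have e2 : (z - x) * ((z - y) / (z - x) * F (c n * x + b n) +
      (y - x) / (z - x) * F (c n * z + b n)) =
      (z - y) * F (c n * x + b n) + (y - x) * F (c n * z + b n) := by field_simp
  rw [e2] at h2
  have h3 := mul_le_mul_of_nonneg_left h2 (n.cast_nonneg (α := ℝ))
  linarith

theorem eventually_arg_neg (hF1 : ∀ x, 0 ≤ x → F x = 1)
    (hw : WeaklyConverges (fun n x => F (c n * x + b n) ^ n) G) {x : ℝ}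
    (hx : ContinuousAt G x) (hGx : G x < 1) : ∀ᶠ n in atTop, c n * x + b n < 0 := by
  filter_upwards [(hw x hx).eventually (gt_mem_nhds hGx)] with n hn
  by_contra! hcon
  rw [hF1 _ hcon, one_pow] at hn
  exact lt_irrefl _ hn

/-- For a distribution function which is convex on the left of its right endpoint, a
non-degenerate limit law is everywhere positive. -/
theorem limit_pos (hF : IsDistributionFunction F) (hF1 : ∀ x, 0 ≤ x → F x = 1)
    (hconv : ConvexOn ℝ (Iic 0) F) (hG : IsDistributionFunction G) (hnd : ¬ IsDegenerate G)
    (hc : ∀ n, 0 < c n) (hw : WeaklyConverges (fun n x => F (c n * x + b n) ^ n) G) (x : ℝ) :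
    0 < G x := by
  obtain ⟨y, z, hyz, hy, hz, hGy, hGz⟩ := hG.exists_continuousAt_pair hnd
  obtain ⟨u, -, hu, huc⟩ := hG.exists_continuousAt (sub_one_lt (min x y))
  have hux : u < x := hu.trans_le (min_le_left _ _)
  have huy : u < y := hu.trans_le (min_le_right _ _)
  refine lt_of_lt_of_le ?_ (hG.monotone hux.le)
  have hlim := tendsto_mul_one_sub_of_pow (fun n => hF.nonneg _) hGy (hw y hy)
  set K : ℝ := -Real.log (G y) + 1
  -- `M` comes from `tail_concave` at `u < y < z` after dropping the nonnegative term at `z`: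
  -- concavity bounds the tail at `u` by a multiple of the one at `y`.
  refine limit_pow_pos (M := (z - u) * K / (z - y)) ?_ (hw u huc)
  filter_upwards [eventually_arg_neg hF1 hw hz hGz,
    hlim.eventually (gt_mem_nhds (lt_add_one _))] with n hn hK
  have h1 := tail_concave hconv hc huy hyz hn.le
  have h2 : 0 ≤ (y - u) * (n * (1 - F (c n * z + b n))) :=
    mul_nonneg (by linarith) (mul_nonneg n.cast_nonneg (by linarith [hF.le_one (c n * z + b n)]))
  have h3 : (z - u) * (n * (1 - F (c n * y + b n))) ≤ (z - u) * K :=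
    mul_le_mul_of_nonneg_left hK.le (by linarith)
  rw [le_div_iff₀ (by linarith)]
  linarith

theorem tendsto_tail (hF : IsDistributionFunction F) (hpos : ∀ x, 0 < G x)
    (hw : WeaklyConverges (fun n x => F (c n * x + b n) ^ n) G) {x : ℝ} (hx : ContinuousAt G x) :
    Tendsto (fun n : ℕ => n * (1 - F (c n * x + b n))) atTop (𝓝 (-Real.log (G x))) :=
  tendsto_mul_one_sub_of_pow (fun _ => hF.nonneg _) (hpos x) (hw x hx)

theorem neg_log_nonneg (hG : IsDistributionFunction G) (x : ℝ) : 0 ≤ -Real.log (G x) :=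
  neg_nonneg.2 (Real.log_nonpos (hG.nonneg x) (hG.le_one x))

/-- Negative arguments along infinitely many `n` are enough, because all three tails converge.
`tendsto_norming` needs this weak form. -/
theorem limit_concave_of_continuousAt (hF : IsDistributionFunction F)
    (hconv : ConvexOn ℝ (Iic 0) F) (hpos : ∀ x, 0 < G x)
    (hc : ∀ n, 0 < c n) (hw : WeaklyConverges (fun n x => F (c n * x + b n) ^ n) G)
    {x y z : ℝ} (hxy : x < y) (hyz : y < z) (hx : ContinuousAt G x) (hy : ContinuousAt G y)
    (hz : ContinuousAt G z) (hneg : ∃ᶠ n in atTop, c n * z + b n < 0) :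
    (z - y) * -Real.log (G x) + (y - x) * -Real.log (G z) ≤ (z - x) * -Real.log (G y) :=
  le_of_tendsto_of_tendsto_of_frequently
    (((tendsto_tail hF hpos hw hx).const_mul _).add ((tendsto_tail hF hpos hw hz).const_mul _))
    ((tendsto_tail hF hpos hw hy).const_mul _)
    (hneg.mono fun _ hn => tail_concave hconv hc hxy hyz hn.le)

theorem tendsto_neg_log_atBot (hG : IsDistributionFunction G) (hpos : ∀ x, 0 < G x) :
    Tendsto (fun x => -Real.log (G x)) atBot atTop := by
  refine tendsto_neg_atBot_atTop.comp (Real.tendsto_log_nhdsGT_zero.comp ?_)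
  exact tendsto_nhdsWithin_iff.2 ⟨hG.tendsto_atBot, Eventually.of_forall hpos⟩

theorem bddAbove_limit_lt_one (hF : IsDistributionFunction F) (hF1 : ∀ x, 0 ≤ x → F x = 1)
    (hconv : ConvexOn ℝ (Iic 0) F) (hG : IsDistributionFunction G) (hpos : ∀ x, 0 < G x)
    (hc : ∀ n, 0 < c n) (hw : WeaklyConverges (fun n x => F (c n * x + b n) ^ n) G) :
    BddAbove {x | G x < 1} := by
  obtain ⟨y, -, -, hy⟩ := hG.exists_continuousAt zero_lt_one
  obtain ⟨t, ht, hty⟩ := ((hG.tendsto_atBot.eventually (gt_mem_nhds (hpos y))).and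
    (eventually_lt_atBot y)).exists
  obtain ⟨x, -, hxt, hx⟩ := hG.exists_continuousAt (sub_one_lt t)
  have hxy : x < y := hxt.trans hty
  have hlog : -Real.log (G y) < -Real.log (G x) :=
    neg_lt_neg (Real.log_lt_log (hpos x) ((hG.monotone hxt.le).trans_lt ht))
  set g : ℝ → ℝ := fun x => -Real.log (G x) with hg
  have hd : 0 < g x - g y := sub_pos.2 hlog
  -- The second entry is the zero of the line through `(x, g x)` and `(y, g y)`. Beyond it,
  -- concavity would push `g` below `0` at a point where `G < 1`.
  refine ⟨max y ((y * g x - x * g y) / (g x - g y)), fun v hv => ?_⟩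
  by_contra! hcon
  obtain ⟨z, hz1, hzv, hz⟩ := hG.exists_continuousAt hcon
  obtain ⟨hyz, hz2⟩ := max_lt_iff.1 hz1
  have hGz : G z < 1 := (hG.monotone hzv.le).trans_lt hv
  have h1 := limit_concave_of_continuousAt hF hconv hpos hc hw hxy hyz hx hy hz
    (eventually_arg_neg hF1 hw hz hGz).frequently
  have h2 := mul_nonneg (sub_nonneg.2 hxy.le) (neg_log_nonneg hG z)
  rw [div_lt_iff₀ hd] at hz2
  simp only [hg] at *
  linarith

/-- The right endpoint of a distribution function bounded above. -/
noncomputable def rightEndpoint (G : ℝ → ℝ) : ℝ := sSup {x | G x < 1}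

theorem lt_one_of_lt_rightEndpoint (hG : IsDistributionFunction G) {x : ℝ}
    (hx : x < rightEndpoint G) : G x < 1 := by
  have hne : {x | G x < 1}.Nonempty :=
    (hG.tendsto_atBot.eventually (gt_mem_nhds zero_lt_one)).exists
  obtain ⟨y, hy, hxy⟩ := exists_lt_of_lt_csSup hne hx
  exact (hG.monotone hxy.le).trans_lt hy

theorem eq_one_of_rightEndpoint_lt (hG : IsDistributionFunction G) (hb : BddAbove {x | G x < 1})
    {x : ℝ} (hx : rightEndpoint G < x) : G x = 1 := by
  by_contra h
  exact not_lt_of_ge (le_csSup hb ((hG.le_one x).lt_of_ne h)) hx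

/-- The point `-b_n / c_n` is where the rescaled `F` reaches its endpoint `0`. If it stayed right of
`e` by a fixed amount infinitely often, concavity would extend past `e`, where `-log G` vanishes at
two points although it is positive left of `e`. -/
theorem tendsto_norming (hF : IsDistributionFunction F) (hF1 : ∀ x, 0 ≤ x → F x = 1)
    (hconv : ConvexOn ℝ (Iic 0) F) (hG : IsDistributionFunction G) (hpos : ∀ x, 0 < G x)
    (hb : BddAbove {x | G x < 1})
    (hc : ∀ n, 0 < c n) (hw : WeaklyConverges (fun n x => F (c n * x + b n) ^ n) G) :
    Tendsto (fun n => -b n / c n) atTop (𝓝 (rightEndpoint G)) := by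
  refine tendsto_order.2 ⟨fun a ha => ?_, fun a ha => ?_⟩
  · obtain ⟨x, hax, hx, hxc⟩ := hG.exists_continuousAt ha
    filter_upwards [eventually_arg_neg hF1 hw hxc (lt_one_of_lt_rightEndpoint hG hx)] with n hn
    rw [lt_div_iff₀ (hc n)]
    nlinarith [hc n]
  · obtain ⟨z, hz, hza, hzc⟩ := hG.exists_continuousAt ha
    obtain ⟨y, hy, hyz, hyc⟩ := hG.exists_continuousAt hz
    obtain ⟨x, -, hx, hxc⟩ := hG.exists_continuousAt (sub_one_lt (rightEndpoint G))
    by_contra hcon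
    have hfr : ∃ᶠ n in atTop, c n * z + b n < 0 := by
      refine (not_eventually.1 hcon).mono fun n hn => ?_
      rw [not_lt, le_div_iff₀ (hc n)] at hn
      nlinarith [hc n]
    have h1 := limit_concave_of_continuousAt hF hconv hpos hc hw (hx.trans hy) hyz hxc hyc hzc hfr
    rw [eq_one_of_rightEndpoint_lt hG hb hy, eq_one_of_rightEndpoint_lt hG hb hz, Real.log_one,
      neg_zero, mul_zero, mul_zero, add_zero] at h1
    have h2 : 0 < -Real.log (G x) :=
      neg_pos.2 (Real.log_neg (hpos x) (lt_one_of_lt_rightEndpoint hG hx))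
    have := mul_pos (sub_pos.2 hyz) h2
    linarith

theorem concaveOn_neg_log_limit (hF : IsDistributionFunction F) (hF1 : ∀ x, 0 ≤ x → F x = 1)
    (hconv : ConvexOn ℝ (Iic 0) F) (hG : IsDistributionFunction G) (hpos : ∀ x, 0 < G x)
    (hc : ∀ n, 0 < c n) (hw : WeaklyConverges (fun n x => F (c n * x + b n) ^ n) G) :
    ConcaveOn ℝ (Iio (rightEndpoint G)) (fun x => -Real.log (G x)) := by
  refine concaveOn_of_slope_anti_adjacent (convex_Iio _) ?_
  intro x y z hx hz hxy hyz
  have hlim : ∀ u, Tendsto (fun δ => -Real.log (G (u + δ))) (𝓝[>] 0) (𝓝 (-Real.log (G u))) := by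
    intro u
    have h1 : Tendsto (fun δ : ℝ => u + δ) (𝓝[>] 0) (𝓝[>] u) := by
      refine tendsto_nhdsWithin_iff.2 ⟨?_, ?_⟩
      · have : Tendsto (fun δ : ℝ => u + δ) (𝓝 0) (𝓝 (u + 0)) := by
          apply Continuous.tendsto; fun_prop
        rw [add_zero] at this
        exact this.mono_left nhdsWithin_le_nhds
      · filter_upwards [self_mem_nhdsWithin] with δ hδ
        exact lt_add_of_pos_right u hδ
    exact (((hG.tendsto_nhdsGT u).comp h1).log (hpos u).ne').neg
  have hev : ∀ᶠ δ in 𝓝[>] (0 : ℝ), δ < rightEndpoint G - z :=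
    (gt_mem_nhds (sub_pos.2 hz)).filter_mono nhdsWithin_le_nhds
  have key : (z - y) * -Real.log (G x) + (y - x) * -Real.log (G z) ≤
      (z - x) * -Real.log (G y) := by
    -- The inequality holds for shifts `δ` that make all three points continuity points of `G`;
    -- right continuity then gives it at `x, y, z`.
    refine le_of_tendsto_of_tendsto_of_frequently
      (((hlim x).const_mul (z - y)).add ((hlim z).const_mul (y - x)))
      ((hlim y).const_mul (z - x)) ?_
    refine ((hG.frequently_continuousAt x y z).and_eventually hev).mono ?_
    rintro δ ⟨⟨hxc, hyc, hzc⟩, hδ⟩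
    have hGz : G (z + δ) < 1 := lt_one_of_lt_rightEndpoint hG (by linarith)
    have := limit_concave_of_continuousAt hF hconv hpos hc hw (add_lt_add_left hxy δ)
      (add_lt_add_left hyz δ) hxc hyc hzc (eventually_arg_neg hF1 hw hzc hGz).frequently
    simpa only [add_sub_add_right_eq_sub] using this
  rw [div_le_div_iff₀ (by linarith) (by linarith)]
  linarith

/-- If `F` is convex on the left of its right endpoint `0` and attracted to some non-degenerate
law, its tail has a power limit along a suitable scaling. -/
theorem exists_tail_rpow_limit (hF : IsDistributionFunction F) (hF1 : ∀ x, 0 ≤ x → F x = 1)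
    (hFlt : ∀ x, x < 0 → F x < 1)
    (hconv : ConvexOn ℝ (Iic 0) F) (hG : IsDistributionFunction G) (hnd : ¬ IsDegenerate G)
    (hc : ∀ n, 0 < c n) (hw : WeaklyConverges (fun n x => F (c n * x + b n) ^ n) G) :
    ∃ α ∈ Ioc (0 : ℝ) 1, ∃ a : ℕ → ℝ, (∀ n, 0 < a n) ∧
      ∀ y, 0 < y → Tendsto (fun n : ℕ => n * (1 - F (-(a n * y)))) atTop (𝓝 (y ^ α)) := by
  have hpos := limit_pos hF hF1 hconv hG hnd hc hw
  have hb := bddAbove_limit_lt_one hF hF1 hconv hG hpos hc hw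
  have hτ := tendsto_norming hF hF1 hconv hG hpos hb hc hw
  have hconc := concaveOn_neg_log_limit hF hF1 hconv hG hpos hc hw
  set e := rightEndpoint G with he
  have hgcont : ContinuousOn (fun x => -Real.log (G x)) (Iio e) := hconc.continuousOn isOpen_Iio
  have hGcont : ∀ x, x < e → ContinuousAt G x := fun x hx => by
    have h1 := (hgcont.continuousAt (Iio_mem_nhds hx)).neg.rexp
    refine h1.congr (Eventually.of_forall fun y => ?_)
    simp [Real.exp_log (hpos y)]
  set k : ℝ → ℝ := fun y => -Real.log (G (e - y)) with hkdef
  have hkcont : ∀ y, 0 < y → ContinuousAt k y := fun y hy => by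
    have h1 : ContinuousAt (fun x => -Real.log (G x)) (e - y) :=
      hgcont.continuousAt (Iio_mem_nhds (by linarith))
    exact ContinuousAt.comp (f := fun y => e - y) h1 (by fun_prop)
  have hkconc : ConcaveOn ℝ (Ioi 0) k := by
    refine ⟨convex_Ioi 0, fun x hx y hy s t hs ht hst => ?_⟩
    have hx' : (0 : ℝ) < x := hx
    have hy' : (0 : ℝ) < y := hy
    have h1 := hconc.2 (show e - x ∈ Iio e by simpa using hx') (show e - y ∈ Iio e by simpa using hy')
      hs ht hst
    have h2 : s • (e - x) + t • (e - y) = e - (s • x + t • y) := by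
      simp only [smul_eq_mul]; linear_combination e * hst
    rwa [h2] at h1
  have hkpos : ∀ y, 0 < y → 0 < k y := fun y hy =>
    neg_pos.2 (Real.log_neg (hpos _) (lt_one_of_lt_rightEndpoint hG (by linarith)))
  have hktop : Tendsto k atTop atTop :=
    (tendsto_neg_log_atBot hG hpos).comp (tendsto_atBot_add_const_left _ e tendsto_neg_atTop_atBot)
  set h : ℝ → ℝ := fun y => 1 - F (-y) with hhdef
  have hm : Monotone h := fun x y hxy => sub_le_sub_left (hF.monotone (neg_le_neg hxy)) 1
  have hh : ∀ y, 0 < y → 0 < h y := fun y hy => sub_pos.2 (hFlt _ (by linarith))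
  have hlim : ∀ y, 0 < y → Tendsto (fun n : ℕ => n * h (c n * y)) atTop (𝓝 (k y)) := by
    intro y hy
    -- At `r_n = y + e + b_n / c_n → y` the argument `c_n (e - r_n) + b_n` equals `-c_n y`, so the
    -- centering is absorbed into a moving argument.
    have hr : Tendsto (fun n => y + e - -b n / c n) atTop (𝓝 y) := by
      have := (tendsto_const_nhds (x := y + e)).sub hτ
      rwa [add_sub_cancel_right] at this
    have := tendsto_comp_of_monotone
      (φ := fun (n : ℕ) r => (n : ℝ) * (1 - F (c n * (e - r) + b n))) isOpen_Ioi
      (fun n r r' hrr' => mul_le_mul_of_nonneg_left (sub_le_sub_left (hF.monotone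
        (by nlinarith [mul_le_mul_of_nonneg_left hrr' (hc n).le])) 1) n.cast_nonneg)
      (fun r (hr : r ∈ Ioi (0 : ℝ)) => tendsto_tail hF hpos hw
        (hGcont (e - r) (sub_lt_self e hr))) hy (hkcont y hy) hr
    refine this.congr fun n => ?_
    have hcn := (hc n).ne'
    have e1 : c n * (e - (y + e - -b n / c n)) + b n = -(c n * y) := by field_simp; ring
    rw [e1]
  obtain ⟨α, hα, hkα⟩ := exists_rpow_limit hm hh hc hlim hkpos hkconc hktop
  have hk1 := hkpos 1 one_pos
  -- Rescaling by this factor turns the constant `k 1` into `1`.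
  have hs : 0 < k 1 ^ (-α⁻¹) := Real.rpow_pos_of_pos hk1 _
  refine ⟨α, hα, fun n => c n * k 1 ^ (-α⁻¹), fun n => mul_pos (hc n) hs, fun y hy => ?_⟩
  have h1 := hlim (k 1 ^ (-α⁻¹) * y) (mul_pos hs hy)
  have h2 : k (k 1 ^ (-α⁻¹) * y) = y ^ α := by
    rw [hkα _ (mul_pos hs hy), Real.mul_rpow hs.le hy.le, ← Real.rpow_mul hk1.le,
      show -α⁻¹ * α = -1 by have := hα.1.ne'; field_simp, Real.rpow_neg_one]
    field_simp
  rw [h2] at h1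
  refine h1.congr fun n => ?_
  rw [mul_assoc]

end ConvexTail

/-! ### The Weibull law and its domain of attraction -/

theorem isDistributionFunction_weibullDF {α : ℝ} (hα : 0 < α) :
    IsDistributionFunction (weibullDF α) := by
  have hcont : Continuous (weibullDF α) := by
    -- Both branches merge into one continuous formula because `0 ^ α = 0` for `α > 0`.
    have : weibullDF α = fun x => Real.exp (-(max (-x) 0 ^ α)) := by
      funext x
      unfold weibullDF
      split_ifs with hx
      · rw [max_eq_left (by linarith)]
      · rw [max_eq_right (by linarith), Real.zero_rpow hα.ne', neg_zero, Real.exp_zero]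
    rw [this]
    exact (((continuous_neg.max continuous_const).rpow_const fun _ => Or.inr hα.le).neg).rexp
  refine ⟨fun x y hxy => ?_, fun x => hcont.continuousWithinAt, ?_, ?_⟩
  · unfold weibullDF
    split_ifs with hx hy hy
    · exact Real.exp_le_exp.2 (neg_le_neg
        (Real.rpow_le_rpow (by linarith) (neg_le_neg hxy) hα.le))
    · exact Real.exp_le_one_iff.2 (neg_nonpos.2 (Real.rpow_nonneg (by linarith) _))
    · exact absurd (hxy.trans_lt hy) hx
    · exact le_rfl
  · have h1 : Tendsto (fun x : ℝ => Real.exp (-((-x) ^ α))) atBot (𝓝 0) :=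
      Real.tendsto_exp_atBot.comp (tendsto_neg_atTop_atBot.comp
        ((tendsto_rpow_atTop hα).comp tendsto_neg_atBot_atTop))
    refine h1.congr' ?_
    filter_upwards [eventually_lt_atBot 0] with x hx
    exact (if_pos hx).symm
  · refine tendsto_const_nhds.congr' ?_
    filter_upwards [eventually_ge_atTop 0] with x hx
    exact (if_neg (not_lt.2 hx)).symm

theorem not_isDegenerate_weibullDF (α : ℝ) : ¬ IsDegenerate (weibullDF α) := by
  rintro ⟨a, ha⟩
  have h := ha (-1)
  have h1 : weibullDF α (-1) = Real.exp (-1) := by simp [weibullDF]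
  rw [h1] at h
  split_ifs at h
  · exact (Real.exp_lt_one_iff.2 (by norm_num : (-1 : ℝ) < 0)).ne h
  · exact (Real.exp_pos _).ne' h

theorem inMDA_weibullDF_of_tail {F : ℝ → ℝ} (hF : IsDistributionFunction F)
    (hF1 : ∀ x, 0 ≤ x → F x = 1) {α : ℝ} (hα : 0 < α) {a : ℕ → ℝ} (ha : ∀ n, 0 < a n)
    (hlim : ∀ y, 0 < y → Tendsto (fun n : ℕ => n * (1 - F (-(a n * y)))) atTop (𝓝 (y ^ α))) :
    InMDA F (weibullDF α) := by
  refine ⟨hF, isDistributionFunction_weibullDF hα, not_isDegenerate_weibullDF α, a, fun _ => 0, ha,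
    fun x _ => ?_⟩
  simp only [add_zero]
  rcases lt_or_ge x 0 with hx | hx
  · have h1 := Real.tendsto_one_add_pow_exp_of_tendsto
      (g := fun n => -(1 - F (-(a n * -x)))) (t := -((-x) ^ α))
      ((hlim (-x) (by linarith)).neg.congr fun n => by ring)
    rw [show weibullDF α x = Real.exp (-((-x) ^ α)) from if_pos hx]
    refine h1.congr fun n => ?_
    rw [mul_neg, neg_neg]
    ring
  · rw [show weibullDF α x = 1 from if_neg (not_lt.2 hx)]
    refine tendsto_const_nhds.congr fun n => ?_
    rw [hF1 _ (mul_nonneg (ha n).le hx), one_pow]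

theorem convexOn_reflectedDF {ψ : ℝ → ℝ} (hc : ConvexOn ℝ (Ici 0) ψ) :
    ConvexOn ℝ (Iic 0) (reflectedDF ψ) := by
  refine ⟨convex_Iic 0, fun x hx y hy s t hs ht hst => ?_⟩
  have hx' : x ≤ 0 := hx
  have hy' : y ≤ 0 := hy
  have hz : s • x + t • y ≤ 0 := (convex_Iic (0 : ℝ)) hx hy hs ht hst
  have h1 := hc.2 (show -x ∈ Ici 0 by simpa using hx') (show -y ∈ Ici 0 by simpa using hy')
    hs ht hst
  simp only [reflectedDF, if_pos hx', if_pos hy', if_pos hz]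
  rwa [smul_neg, smul_neg, ← neg_add] at h1

end ArchEVT

theorem mainTheorem6 (d : ℕ) (ψ : ℝ → ℝ)
    (hψ : ArchEVT.IsArchimedeanGenerator ψ) (hd : ArchEVT.IsDMonotone d ψ) :
    ((∀ α : ℝ, ArchEVT.IsRegularlyVarying (fun x => 1 - ψ x⁻¹) (-α) → α ∈ Set.Icc (0 : ℝ) 1) ∧
      ¬ ArchEVT.IsRapidlyVarying (fun x => 1 - ψ x⁻¹)) ∧
    ((∃ G : ℝ → ℝ, ArchEVT.InMDA (ArchEVT.reflectedDF ψ) G) →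
      ∃ α : ℝ, α ∈ Set.Ioc (0 : ℝ) 1 ∧
        ArchEVT.InMDA (ArchEVT.reflectedDF ψ) (ArchEVT.weibullDF α)) := by
  have hc := ArchEVT.convexOn_Ici_of_convexOn_Ioi hd.convexOn_Ioi hψ.continuousOn
  refine ⟨⟨fun α h => ArchEVT.index_mem_Icc hψ hc h, ArchEVT.not_isRapidlyVarying hψ hc⟩, ?_⟩
  rintro ⟨G, hF, hG, hnd, c, b, hcpos, hw⟩
  have hF1 : ∀ x, 0 ≤ x → ArchEVT.reflectedDF ψ x = 1 := fun x hx => by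
    unfold ArchEVT.reflectedDF
    split_ifs with h
    · rw [le_antisymm h hx, neg_zero, hψ.map_zero]
    · rfl
  have hFlt : ∀ x, x < 0 → ArchEVT.reflectedDF ψ x < 1 := fun x hx => by
    rw [ArchEVT.reflectedDF, if_pos hx.le]
    exact hψ.lt_one (neg_pos.2 hx)
  obtain ⟨α, hα, a, ha, hlim⟩ := ArchEVT.exists_tail_rpow_limit hF hF1 hFlt
    (ArchEVT.convexOn_reflectedDF hc) hG hnd hcpos hw
  exact ⟨α, hα, ArchEVT.inMDA_weibullDF_of_tail hF hF1 hα.1 ha hlim⟩
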